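/- Let $k,n$ be natural numbers, let $A_1,\dots,A_k\in\mathbb R^{n\times n}$, and for $i=1,\dots,k$ let $B_i$ be the $2n\times 2n$ matrix \[ B_i=\begin{pmatrix}0_{n\times n} & A_i^T\\ -A_i & -I_{n\times n}\end{pmatrix}. \] Then the following are equivalent: (i) there exist a norm $\|\cdot\|$ on $\mathbb R^{2n}$ and a real number $a>0$ such that the induced operator norm $\|M\|=\sup\{\|Mx\| : x\in\mathbb R^{2n},\ \|x\|=1\}$ satisfies \[ \|e^{B_i t}\|\le e^{-at}\qquad\text{for all } t\ge 0 \text{ and all } i=1,\dots,k; \] (ii) every matrix in the convex hull $\{\sum_{i=1}^k\alpha_iA_i : \alpha_i\ge 0,\ \sum_{i=1}^k\alpha_i=1\}$ of $A_1,\dots,A_k$ is nonsingular. -/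

import Mathlib

open scoped Matrix

/-- The block matrix `[[0, Aᵀ], [-A, -I]]`, of size `2n × 2n`; the index type `Fin n ⊕ Fin n`
lists the first `n` and then the last `n` coordinates of `ℝ²ⁿ`. -/
def blockMatrix {n : ℕ} (A : Matrix (Fin n) (Fin n) ℝ) :
    Matrix (Fin n ⊕ Fin n) (Fin n ⊕ Fin n) ℝ :=
  Matrix.fromBlocks 0 Aᵀ (-A) (-1)

/-- A seminorm is a norm if it vanishes only at `0`. -/
def IsNorm {ι : Type} (N : Seminorm ℝ (ι → ℝ)) : Prop :=
  ∀ x, N x = 0 → x = 0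

/-- The operator norm of a square matrix induced by the norm `N` on vectors:
the supremum of `N (M x)` over all `x` with `N x = 1`. -/
noncomputable def inducedNorm {ι : Type} [Fintype ι] (N : Seminorm ℝ (ι → ℝ))
    (M : Matrix ι ι ℝ) : ℝ :=
  sSup {r : ℝ | ∃ x : ι → ℝ, N x = 1 ∧ r = N (M *ᵥ x)}

/-!
If the flow of `B` contracts the norm `N` at rate `a`, then a functional `f` norming `x` satisfies
`f (B x) ≤ -a * N x`. This is linear in `B`, so it persists on the convex hull, and no matrix there
kills a nonzero vector; but if `M u = 0`, then `blockMatrix M` kills `(u, 0)`.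

Conversely, along the flow of `blockMatrix A` at `x = (p, q)` the derivative of `|x|²` is
`-2 * |q|²`, which vanishes exactly where `q = 0`. If the convex hull of the matrices `A` consists
of nonsingular matrices, Hahn-Banach and a smooth partition of unity provide functionals `g p`,
smooth in `p`, with `g p (A p) > 0` for all these `A` at once. The function `g p q` then decreases
strictly where `q = 0`, so a small multiple of it turns `|x|²` into a strict common Lyapunov
function away from the origin. Some sublevel set of that function is invariant under all maps
`exp (a * t) • exp (t • B)` for small `a > 0`; so is its absolutely convex hull, because the maps
are linear, and the gauge of this hull is the required norm.
-/

open Filter Set Topology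
open scoped ContDiff Manifold

section Norms

theorem IsNorm.pos {ι : Type} {N : Seminorm ℝ (ι → ℝ)} (hN : IsNorm N) {x : ι → ℝ} (hx : x ≠ 0) :
    0 < N x :=
  (apply_nonneg N x).lt_of_ne' (mt (hN x) hx)

theorem continuous_seminorm_of_finiteDimensional {E : Type*} [NormedAddCommGroup E]
    [NormedSpace ℝ E] [FiniteDimensional ℝ E] (N : Seminorm ℝ E) : Continuous N :=
  continuousOn_univ.1 (N.convexOn.continuousOn isOpen_univ)

variable {ι : Type} [Fintype ι] {N : Seminorm ℝ (ι → ℝ)}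

theorem IsNorm.exists_mul_norm_le (hN : IsNorm N) : ∃ c > 0, ∀ x, c * ‖x‖ ≤ N x := by
  obtain ⟨c, hc, hcN⟩ := (isCompact_sphere (0 : ι → ℝ) 1).exists_forall_le'
    (continuous_seminorm_of_finiteDimensional N).continuousOn (a := 0)
    fun x hx => hN.pos (ne_zero_of_mem_unit_sphere ⟨x, hx⟩)
  refine ⟨c, hc, fun x => ?_⟩
  rcases eq_or_ne x 0 with rfl | hx
  · simp
  have hnorm : 0 < ‖x‖ := norm_pos_iff.2 hx
  have hunit := hcN (‖x‖⁻¹ • x) (by simp [norm_smul, hnorm.ne'])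
  rwa [map_smul_eq_mul, norm_inv, norm_norm, inv_mul_eq_div, le_div_iff₀ hnorm] at hunit

theorem IsNorm.bddAbove_apply_mulVec (hN : IsNorm N) (M : Matrix ι ι ℝ) :
    BddAbove {r : ℝ | ∃ x : ι → ℝ, N x = 1 ∧ r = N (M *ᵥ x)} := by
  obtain ⟨c, hc, hcN⟩ := hN.exists_mul_norm_le
  obtain ⟨C, hC, hCM⟩ := (N.comp M.mulVecLin).bound_of_continuous_normedSpace
    (continuous_seminorm_of_finiteDimensional _)
  refine ⟨C * c⁻¹, ?_⟩
  rintro _ ⟨x, hx, rfl⟩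
  have hxc : ‖x‖ ≤ c⁻¹ := by
    rw [← mul_one c⁻¹, le_inv_mul_iff₀ hc, ← hx]
    exact hcN x
  exact (hCM x).trans (by gcongr)

theorem IsNorm.inducedNorm_le_iff (hN : IsNorm N) {M : Matrix ι ι ℝ} {c : ℝ} (hc : 0 ≤ c) :
    inducedNorm N M ≤ c ↔ ∀ x, N (M *ᵥ x) ≤ c * N x := by
  constructor
  · intro h x
    rcases eq_or_ne x 0 with rfl | hx
    · simp
    have hNx := hN.pos hx
    have hunit : N ((N x)⁻¹ • x) = 1 := by
      rw [map_smul_eq_mul, norm_inv, Real.norm_of_nonneg hNx.le, inv_mul_cancel₀ hNx.ne']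
    have hle := (le_csSup (hN.bddAbove_apply_mulVec M) ⟨_, hunit, rfl⟩).trans h
    rwa [Matrix.mulVec_smul, map_smul_eq_mul, norm_inv, Real.norm_of_nonneg hNx.le,
      inv_mul_eq_div, div_le_iff₀ hNx] at hle
  · refine fun h => Real.sSup_le ?_ hc
    rintro _ ⟨x, hx, rfl⟩
    simpa only [hx, mul_one] using h x

theorem exists_linearMap_apply_eq_seminorm {E : Type*} [AddCommGroup E] [Module ℝ E]
    (N : Seminorm ℝ E) {x : E} (hx : x ≠ 0) :
    ∃ f : E →ₗ[ℝ] ℝ, f x = N x ∧ ∀ y, f y ≤ N y := by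
  obtain ⟨f, hf, hfN⟩ := exists_extension_of_le_sublinear
    (LinearPMap.mkSpanSingleton x (N x) hx) N
    (fun c hc y => by rw [map_smul_eq_mul, Real.norm_of_nonneg hc.le])
    (map_add_le_add N) (by
      rintro ⟨y, hy⟩
      obtain ⟨c, rfl⟩ := Submodule.mem_span_singleton.1 hy
      rw [LinearPMap.mkSpanSingleton'_apply, map_smul_eq_mul, smul_eq_mul]
      exact mul_le_mul_of_nonneg_right (le_abs_self c) (apply_nonneg N x))
  refine ⟨f, ?_, hfN⟩
  rw [hf ⟨x, Submodule.mem_span_singleton_self x⟩]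
  exact LinearPMap.mkSpanSingleton_apply ℝ ℝ hx (N x)

theorem mapsTo_absConvexHull {E F : Type*} [AddCommGroup E] [Module ℝ E] [AddCommGroup F]
    [Module ℝ F] {s : Set E} {t : Set F} {T : E →ₗ[ℝ] F} (hT : MapsTo T s t) :
    MapsTo T (absConvexHull ℝ s) (absConvexHull ℝ t) :=
  absConvexHull_min (fun _ hx => subset_absConvexHull (hT hx))
    ⟨fun a ha => by
      rintro _ ⟨y, hy, rfl⟩
      change T (a • y) ∈ absConvexHull ℝ t
      rw [map_smul]
      exact balanced_absConvexHull a ha (smul_mem_smul_set hy),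
     convex_absConvexHull.linear_preimage T⟩

theorem gauge_map_le_of_mapsTo {E F : Type*} [AddCommGroup E] [Module ℝ E] [AddCommGroup F]
    [Module ℝ F] {s : Set E} {t : Set F} (hs : Absorbent ℝ s) {T : E →ₗ[ℝ] F}
    (hT : MapsTo T s t) (x : E) : gauge t (T x) ≤ gauge s x := by
  refine le_of_forall_gt_imp_ge_of_dense fun r hr => ?_
  obtain ⟨b, hb, hbr, y, hy, rfl⟩ := exists_lt_of_gauge_lt hs hr
  exact (gauge_le_of_mem hb.le ⟨T y, hT hy, (map_smul T b y).symm⟩).trans hbr.le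

theorem exists_seminorm_forall_mapsTo_apply_le {E : Type*} [NormedAddCommGroup E]
    [NormedSpace ℝ E] {S : Set E} (hS : S ∈ 𝓝 0) (hb : Bornology.IsBounded S) :
    ∃ N : Seminorm ℝ E, (∀ x, N x = 0 → x = 0) ∧
      ∀ T : E →ₗ[ℝ] E, MapsTo T S S → ∀ x, N (T x) ≤ N x := by
  have habs : Absorbent ℝ (absConvexHull ℝ S) :=
    absorbent_nhds_zero (mem_of_superset hS subset_absConvexHull)
  have hbounded : Bornology.IsBounded (absConvexHull ℝ S) := by
    obtain ⟨r, hr⟩ := hb.subset_ball 0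
    exact Metric.isBounded_ball.subset
      (absConvexHull_min hr ⟨balanced_ball_zero, convex_ball _ _⟩)
  exact ⟨gaugeSeminorm balanced_absConvexHull convex_absConvexHull habs,
    fun x => (gauge_eq_zero habs (NormedSpace.isVonNBounded_of_isBounded ℝ hbounded)).1,
    fun T hT => gauge_map_le_of_mapsTo habs (mapsTo_absConvexHull hT)⟩

end Norms

section ExponentialContraction

variable {ι : Type} [Fintype ι] [DecidableEq ι]

open scoped Matrix.Norms.Operator in
theorem hasDerivAt_exp_smul_mulVec (B : Matrix ι ι ℝ) (x : ι → ℝ) (t : ℝ) :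
    HasDerivAt (fun s : ℝ => NormedSpace.exp (s • B) *ᵥ x)
      (B *ᵥ (NormedSpace.exp (t • B) *ᵥ x)) t := by
  let evalAt : Matrix ι ι ℝ →L[ℝ] (ι → ℝ) :=
    LinearMap.toContinuousLinearMap ((Matrix.mulVecBilin ℝ ℝ).flip x)
  rw [Matrix.mulVec_mulVec]
  exact evalAt.hasFDerivAt.comp_hasDerivAt t (hasDerivAt_exp_smul_const' (𝕂 := ℝ) B t)

/-- The flow of `ẋ = B x` contracts the seminorm `N` exponentially at rate `a`. -/
def ContractsAtRate (N : Seminorm ℝ (ι → ℝ)) (a : ℝ) (B : Matrix ι ι ℝ) : Prop :=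
  ∀ t : ℝ, 0 ≤ t → ∀ x, N (NormedSpace.exp (t • B) *ᵥ x) ≤ Real.exp (-a * t) * N x

theorem IsNorm.contractsAtRate_iff {N : Seminorm ℝ (ι → ℝ)} (hN : IsNorm N) {a : ℝ}
    {B : Matrix ι ι ℝ} :
    ContractsAtRate N a B ↔
      ∀ t : ℝ, 0 ≤ t → inducedNorm N (NormedSpace.exp (t • B)) ≤ Real.exp (-a * t) :=
  forall₂_congr fun _ _ => (hN.inducedNorm_le_iff (Real.exp_pos _).le).symm

theorem ContractsAtRate.apply_mulVec_le {N : Seminorm ℝ (ι → ℝ)} {a : ℝ} {B : Matrix ι ι ℝ}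
    (hB : ContractsAtRate N a B) {f : (ι → ℝ) →ₗ[ℝ] ℝ} (hf : ∀ y, f y ≤ N y) {x : ι → ℝ}
    (hfx : f x = N x) : f (B *ᵥ x) ≤ -a * N x := by
  have hflow : HasDerivAt (fun t : ℝ => f (NormedSpace.exp (t • B) *ᵥ x)) (f (B *ᵥ x)) 0 := by
    simpa [Function.comp_def] using f.toContinuousLinearMap.hasFDerivAt.comp_hasDerivAt 0
      (hasDerivAt_exp_smul_mulVec B x 0)
  have hbound : HasDerivAt (fun t : ℝ => Real.exp (-a * t) * N x) (-a * N x) 0 := by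
    simpa using ((hasDerivAt_id (0 : ℝ)).const_mul (-a)).exp.mul_const (N x)
  have hslope := (hflow.sub hbound).hasDerivWithinAt (s := Ioi 0)
  rw [hasDerivWithinAt_iff_tendsto_slope' self_notMem_Ioi] at hslope
  refine sub_nonpos.1 (le_of_tendsto hslope ?_)
  filter_upwards [self_mem_nhdsWithin] with t (ht : 0 < t)
  rw [slope_def_field]
  refine div_nonpos_of_nonpos_of_nonneg ?_ (sub_nonneg.2 ht.le)
  simpa [hfx] using (hf _).trans (hB t ht.le x)

theorem mulVec_ne_zero_of_mem_convexHull_of_contractsAtRate {N : Seminorm ℝ (ι → ℝ)}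
    (hN : IsNorm N) {a : ℝ} (ha : 0 < a) {ℬ : Set (Matrix ι ι ℝ)}
    (hℬ : ∀ B ∈ ℬ, ContractsAtRate N a B) {B : Matrix ι ι ℝ} (hB : B ∈ convexHull ℝ ℬ)
    {x : ι → ℝ} (hx : x ≠ 0) : B *ᵥ x ≠ 0 := by
  intro hBx
  obtain ⟨f, hfx, hf⟩ := exists_linearMap_apply_eq_seminorm N hx
  let φ : Matrix ι ι ℝ →ₗ[ℝ] ℝ := f ∘ₗ (Matrix.mulVecBilin ℝ ℝ).flip x
  have hφ : φ B ≤ -a * N x :=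
    convexHull_min (fun C hC => (hℬ C hC).apply_mulVec_le hf hfx)
      (convex_halfSpace_le φ.isLinear _) hB
  have hφ0 : φ B = 0 := (congrArg f hBx).trans (map_zero f)
  linarith [mul_pos ha (hN.pos hx)]

end ExponentialContraction

section Lyapunov

theorem eventually_forall_add_mul_neg {X : Type*} [TopologicalSpace X] {K : Set X}
    (hK : IsCompact K) {f h : X → ℝ} (hf : Continuous f) (hh : Continuous h)
    (hf0 : ∀ x ∈ K, f x ≤ 0) (hh0 : ∀ x ∈ K, f x = 0 → h x < 0) :
    ∀ᶠ ε in 𝓝[>] (0 : ℝ), ∀ x ∈ K, f x + ε * h x < 0 := by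
  have hKh : IsCompact (K ∩ {x | 0 ≤ h x}) :=
    hK.inter_right (isClosed_le continuous_const hh)
  obtain ⟨c, hc, hcf⟩ := hKh.exists_forall_le' hf.neg.continuousOn (a := 0)
    fun x ⟨hxK, hx⟩ => neg_pos.2 ((hf0 x hxK).lt_of_ne fun h0 => (hh0 x hxK h0).not_ge hx)
  obtain ⟨M, hM⟩ := hKh.bddAbove_image hh.continuousOn
  have hlim : Tendsto (fun ε : ℝ => ε * M) (𝓝[>] 0) (𝓝 0) :=
    ((continuous_mul_const M).tendsto' 0 0 (zero_mul M)).mono_left nhdsWithin_le_nhds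
  filter_upwards [hlim.eventually_lt_const hc, self_mem_nhdsWithin] with ε hεM (hε : 0 < ε) x hx
  rcases le_or_gt 0 (h x) with hpos | hneg
  · have hcfx : c ≤ -f x := hcf x ⟨hx, hpos⟩
    have hhM : ε * h x ≤ ε * M :=
      mul_le_mul_of_nonneg_left (hM (mem_image_of_mem h ⟨hx, hpos⟩)) hε.le
    linarith
  · linarith [hf0 x hx, mul_neg_of_pos_of_neg hε hneg]

variable {ι : Type} [Fintype ι]

theorem continuous_fderiv_mulVec {W : (ι → ℝ) → ℝ} (hW : ContDiff ℝ 1 W) :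
    Continuous fun z : Matrix ι ι ℝ × (ι → ℝ) => fderiv ℝ W z.2 (z.1 *ᵥ z.2) :=
  ((hW.continuous_fderiv one_ne_zero).comp continuous_snd).clm_apply
    (continuous_fst.matrix_mulVec continuous_snd)

variable [DecidableEq ι]

theorem apply_exp_smul_mulVec_le {B : Matrix ι ι ℝ} {W : (ι → ℝ) → ℝ} (hW : Differentiable ℝ W)
    {r a : ℝ} (hr : ∀ x, W x = r → fderiv ℝ W x (B *ᵥ x) + a * fderiv ℝ W x x < 0)
    {x : ι → ℝ} (hx : W x ≤ r) {t : ℝ} (ht : 0 ≤ t) :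
    W (Real.exp (a * t) • (NormedSpace.exp (t • B) *ᵥ x)) ≤ r := by
  let y : ℝ → ι → ℝ := fun s => Real.exp (a * s) • (NormedSpace.exp (s • B) *ᵥ x)
  have hy : ∀ s, HasDerivAt y (B *ᵥ y s + a • y s) s := fun s => by
    have hexp : HasDerivAt (fun s : ℝ => Real.exp (a * s)) (Real.exp (a * s) * a) s := by
      simpa using ((hasDerivAt_id s).const_mul a).exp
    refine (hexp.smul (hasDerivAt_exp_smul_mulVec B x s)).congr_deriv ?_
    simp only [y, Matrix.mulVec_smul, smul_smul, mul_comm a]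
  have hWy : ∀ s, HasDerivAt (W ∘ y) (fderiv ℝ W (y s) (B *ᵥ y s + a • y s)) s := fun s =>
    (hW (y s)).hasFDerivAt.comp_hasDerivAt s (hy s)
  refine image_le_of_deriv_right_lt_deriv_boundary
    (fun s _ => (hWy s).continuousAt.continuousWithinAt) (fun s _ => (hWy s).hasDerivWithinAt)
    (B := fun _ => r) (by simpa [y] using hx) (fun s => hasDerivAt_const s r)
    (fun s _ hs => ?_) (right_mem_Icc.2 ht)
  simpa only [map_add, map_smul, smul_eq_mul] using hr (y s) hs

theorem exists_isNorm_contractsAtRate_of_lyapunov {ℬ : Set (Matrix ι ι ℝ)} (hℬ : IsCompact ℬ)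
    {W : (ι → ℝ) → ℝ} (hW : ContDiff ℝ 1 W) {r : ℝ} (h0 : W 0 < r)
    (hb : Bornology.IsBounded {x | W x ≤ r})
    (hneg : ∀ B ∈ ℬ, ∀ x, W x = r → fderiv ℝ W x (B *ᵥ x) < 0) :
    ∃ (N : Seminorm ℝ (ι → ℝ)) (a : ℝ), IsNorm N ∧ 0 < a ∧ ∀ B ∈ ℬ, ContractsAtRate N a B := by
  have hlevel : IsCompact {x | W x = r} :=
    Metric.isCompact_of_isClosed_isBounded (isClosed_eq hW.continuous continuous_const)
      (hb.subset fun _ => le_of_eq)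
  have hrate := eventually_forall_add_mul_neg (hℬ.prod hlevel) (continuous_fderiv_mulVec hW)
    (h := fun z => fderiv ℝ W z.2 z.2)
    (((hW.continuous_fderiv one_ne_zero).comp continuous_snd).clm_apply continuous_snd)
    (fun z hz => (hneg z.1 hz.1 z.2 hz.2).le) (fun z hz h => ((hneg z.1 hz.1 z.2 hz.2).ne h).elim)
  obtain ⟨a, hWa, ha : 0 < a⟩ := (hrate.and self_mem_nhdsWithin).exists
  obtain ⟨N, hN, hNS⟩ := exists_seminorm_forall_mapsTo_apply_le
    ((hW.continuous.tendsto 0).eventually_le_const h0) hb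
  refine ⟨N, a, hN, ha, fun B hB t ht x => ?_⟩
  have hscaled := hNS (Real.exp (a * t) • (NormedSpace.exp (t • B)).mulVecLin)
    (fun y hy => apply_exp_smul_mulVec_le (hW.differentiable one_ne_zero)
      (fun z hz => hWa (B, z) ⟨hB, hz⟩) hy ht) x
  rwa [LinearMap.smul_apply, Matrix.mulVecLin_apply, map_smul_eq_mul, Real.norm_eq_abs,
    Real.abs_exp, ← le_inv_mul_iff₀ (Real.exp_pos _), ← Real.exp_neg, ← neg_mul] at hscaled

-- Replacing `H` by `arctan ∘ H` keeps the sign of its derivative and makes it bounded, so that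
-- `V + ε * arctan H` stays within `1` of `V` and its level set `2` lies in the shell `1 ≤ V ≤ 3`.
theorem exists_isNorm_contractsAtRate_of_weak_lyapunov {ℬ : Set (Matrix ι ι ℝ)}
    (hℬ : IsCompact ℬ) {V H : (ι → ℝ) → ℝ} (hV : ContDiff ℝ 1 V) (hH : ContDiff ℝ 1 H)
    (h0 : V 0 ≤ 1) (hb : Bornology.IsBounded {x | V x ≤ 3})
    (hnonpos : ∀ B ∈ ℬ, ∀ x, 1 ≤ V x → fderiv ℝ V x (B *ᵥ x) ≤ 0)
    (hneg : ∀ B ∈ ℬ, ∀ x, 1 ≤ V x → fderiv ℝ V x (B *ᵥ x) = 0 →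
      fderiv ℝ H x (B *ᵥ x) < 0) :
    ∃ (N : Seminorm ℝ (ι → ℝ)) (a : ℝ), IsNorm N ∧ 0 < a ∧ ∀ B ∈ ℬ, ContractsAtRate N a B := by
  have hshell : IsCompact {x | 1 ≤ V x ∧ V x ≤ 3} :=
    Metric.isCompact_of_isClosed_isBounded
      ((isClosed_le continuous_const hV.continuous).inter
        (isClosed_le hV.continuous continuous_const))
      (hb.subset fun _ hx => hx.2)
  have hφ : ContDiff ℝ 1 fun x => Real.arctan (H x) := hH.arctan
  have hφneg : ∀ B ∈ ℬ, ∀ x, 1 ≤ V x → fderiv ℝ V x (B *ᵥ x) = 0 →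
      fderiv ℝ (fun x => Real.arctan (H x)) x (B *ᵥ x) < 0 := fun B hB x hx hVx => by
    rw [(hH.differentiable one_ne_zero x).hasFDerivAt.arctan.fderiv]
    exact mul_neg_of_pos_of_neg (by positivity) (hneg B hB x hx hVx)
  have hsmall := eventually_forall_add_mul_neg (hℬ.prod hshell) (continuous_fderiv_mulVec hV)
    (continuous_fderiv_mulVec hφ) (fun z hz => hnonpos z.1 hz.1 z.2 hz.2.1)
    (fun z hz => hφneg z.1 hz.1 z.2 hz.2.1)
  obtain ⟨ε, hε, hε0, hε2⟩ := (hsmall.and (Ioo_mem_nhdsGT one_half_pos)).exists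
  have hclose : ∀ x, |ε * Real.arctan (H x)| < 1 := fun x => by
    have harctan : |Real.arctan (H x)| < 2 := abs_lt.2
      ⟨by linarith [Real.neg_pi_div_two_lt_arctan (H x), Real.pi_lt_four],
        by linarith [Real.arctan_lt_pi_div_two (H x), Real.pi_lt_four]⟩
    rw [abs_mul, abs_of_pos hε0]
    exact (mul_lt_mul'' hε2 harctan hε0.le (abs_nonneg _)).trans_eq (by norm_num)
  have hsublevel : {x | V x + ε * Real.arctan (H x) ≤ 2} ⊆ {x | V x ≤ 3} :=
    fun x (hx : V x + ε * Real.arctan (H x) ≤ 2) =>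
      show V x ≤ 3 by linarith [(abs_lt.1 (hclose x)).1]
  refine exists_isNorm_contractsAtRate_of_lyapunov hℬ (W := fun x => V x + ε * Real.arctan (H x))
    (r := 2) (hV.add (contDiff_const.mul hφ)) ?_ (hb.subset hsublevel) fun B hB x hx => ?_
  · linarith [(abs_lt.1 (hclose 0)).2]
  · have hx13 : 1 ≤ V x ∧ V x ≤ 3 := by
      constructor <;> linarith [(abs_lt.1 (hclose x)).1, (abs_lt.1 (hclose x)).2]
    have hderiv := (hV.differentiable one_ne_zero x).hasFDerivAt.fun_add
      ((hφ.differentiable one_ne_zero x).hasFDerivAt.const_mul ε)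
    rw [hderiv.fderiv]
    exact hε (B, x) ⟨hB, hx13⟩

end Lyapunov

section Selection

theorem isCompact_convexHull {E : Type*} [AddCommGroup E] [Module ℝ E] [TopologicalSpace E]
    [IsTopologicalAddGroup E] [ContinuousSMul ℝ E] [FiniteDimensional ℝ E] {s : Set E}
    (hs : IsCompact s) : IsCompact (convexHull ℝ s) := by
  let combinations (m : ℕ) : Set E :=
    (fun z : (Fin m → ℝ) × (Fin m → E) => ∑ i, z.1 i • z.2 i) ''
      (stdSimplex ℝ (Fin m) ×ˢ univ.pi fun _ => s)
  have hcombinations (m : ℕ) : IsCompact (combinations m) :=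
    ((isCompact_stdSimplex ℝ _).prod (isCompact_univ_pi fun _ => hs)).image (by fun_prop)
  suffices h : convexHull ℝ s = ⋃ m ∈ Iic (Module.finrank ℝ E + 1), combinations m from
    h ▸ (finite_Iic _).isCompact_biUnion fun m _ => hcombinations m
  refine Subset.antisymm (fun x hx => ?_) (iUnion₂_subset fun m _ => ?_)
  · obtain ⟨κ, _, z, w, hz, hind, hw, hw1, rfl⟩ := eq_pos_convex_span_of_mem_convexHull hx
    let e := (Fintype.equivFin κ).symm
    have hcard : Fintype.card κ ≤ Module.finrank ℝ E + 1 :=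
      hind.card_le_finrank_succ.trans (Nat.succ_le_succ (Submodule.finrank_le _))
    refine mem_biUnion (mem_Iic.2 hcard)
      ⟨(w ∘ e, z ∘ e), ⟨⟨fun i => (hw _).le, ?_⟩, fun i _ => hz ⟨_, rfl⟩⟩, ?_⟩
    · exact (e.sum_comp w).trans hw1
    · exact e.sum_comp fun i => w i • z i
  · rintro _ ⟨⟨w, z⟩, ⟨⟨hw, hw1⟩, hz⟩, rfl⟩
    exact mem_convexHull_of_exists_fintype w z hw hw1 (fun i => hz i trivial) rfl

variable {m n : Type*} [Fintype n] {𝒜 : Set (Matrix m n ℝ)}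

theorem exists_dual_mulVec_pos [Finite m] (h𝒜 : IsCompact 𝒜) {p : n → ℝ}
    (hp : ∀ M ∈ convexHull ℝ 𝒜, M *ᵥ p ≠ 0) :
    ∃ f : StrongDual ℝ (m → ℝ), ∀ A ∈ 𝒜, 0 < f (A *ᵥ p) := by
  let evalAt : Matrix m n ℝ →ₗ[ℝ] (m → ℝ) := (Matrix.mulVecBilin ℝ ℝ).flip p
  have hzero : (0 : m → ℝ) ∉ evalAt '' convexHull ℝ 𝒜 := fun ⟨M, hM, hMp⟩ => hp M hM hMp
  obtain ⟨f, u, hu, hf⟩ := geometric_hahn_banach_point_closed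
    ((convex_convexHull ℝ 𝒜).linear_image evalAt)
    ((isCompact_convexHull h𝒜).image evalAt.continuous_of_finiteDimensional).isClosed hzero
  rw [map_zero] at hu
  exact ⟨f, fun A hA => hu.trans (hf _ ⟨A, subset_convexHull ℝ 𝒜 hA, rfl⟩)⟩

-- For each `p` the admissible functionals form a convex set, and an admissible functional stays
-- admissible near `p`, so a smooth partition of unity glues local choices together.
theorem exists_contDiff_dual_mulVec_pos [Fintype m] (h𝒜 : IsCompact 𝒜)
    {s : Set (n → ℝ)} (hs : IsClosed s)
    (hne : ∀ p ∈ s, ∀ M ∈ convexHull ℝ 𝒜, M *ᵥ p ≠ 0) :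
    ∃ g : (n → ℝ) → StrongDual ℝ (m → ℝ), ContDiff ℝ ∞ g ∧
      ∀ p ∈ s, ∀ A ∈ 𝒜, 0 < g p (A *ᵥ p) := by
  let admissible (p : n → ℝ) : Set (StrongDual ℝ (m → ℝ)) :=
    {f | p ∈ s → ∀ A ∈ 𝒜, 0 < f (A *ᵥ p)}
  have hconvex (p : n → ℝ) : Convex ℝ (admissible p) := fun f hf g hg a b ha hb hab hp A hA =>
    convex_Ioi (0 : ℝ) (hf hp A hA) (hg hp A hA) ha hb hab
  have hlocal (p : n → ℝ) : ∃ f, ∀ᶠ p' in 𝓝 p, f ∈ admissible p' := by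
    by_cases hp : p ∈ s
    · obtain ⟨f, hf⟩ := exists_dual_mulVec_pos h𝒜 (hne p hp)
      have hcont : Continuous fun z : (n → ℝ) × Matrix m n ℝ => f (z.2 *ᵥ z.1) :=
        f.continuous.comp (continuous_snd.matrix_mulVec continuous_fst)
      refine ⟨f, (h𝒜.eventually_forall_of_forall_eventually fun A hA =>
        (hcont.tendsto (p, A)).eventually_const_lt (hf A hA)).mono fun p' hp' _ => hp'⟩
    · exact ⟨0, (hs.isOpen_compl.eventually_mem hp).mono fun p' hp' h => (hp' h).elim⟩
  obtain ⟨g, hg⟩ := exists_contMDiffMap_forall_mem_convex_of_local_const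
    (n := ⊤) 𝓘(ℝ, n → ℝ) hconvex hlocal
  exact ⟨g, g.contMDiff.contDiff, hg⟩

end Selection

section DotProduct

variable {ι : Type*} [Fintype ι]

theorem hasFDerivAt_dotProduct_self (x : ι → ℝ) :
    HasFDerivAt (fun x : ι → ℝ => x ⬝ᵥ x)
      ((2 : ℝ) • (dotProductBilin ℝ ℝ x).toContinuousLinearMap) x := by
  have h : HasFDerivAt (fun x : ι → ℝ => x ⬝ᵥ x)
      (∑ i, (x i • ContinuousLinearMap.proj (R := ℝ) (φ := fun _ : ι => ℝ) i +
        x i • ContinuousLinearMap.proj (R := ℝ) (φ := fun _ : ι => ℝ) i)) x :=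
    HasFDerivAt.fun_sum fun i _ => (hasFDerivAt_apply i x).mul (hasFDerivAt_apply i x)
  refine h.congr_fderiv (ContinuousLinearMap.ext fun y => ?_)
  simp [dotProduct, ← two_mul, Finset.mul_sum]

theorem contDiff_dotProduct_self {k : WithTop ℕ∞} : ContDiff ℝ k fun x : ι → ℝ => x ⬝ᵥ x :=
  ContDiff.sum fun i _ => (contDiff_apply ℝ ℝ i).mul (contDiff_apply ℝ ℝ i)

theorem isBounded_dotProduct_self_le (r : ℝ) :
    Bornology.IsBounded {x : ι → ℝ | x ⬝ᵥ x ≤ r} := by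
  refine isBounded_iff_forall_norm_le.2 ⟨√r, fun x hx => ?_⟩
  refine (pi_norm_le_iff_of_nonneg (Real.sqrt_nonneg r)).2 fun i => Real.abs_le_sqrt ?_
  calc x i ^ 2 = x i * x i := sq (x i)
    _ ≤ x ⬝ᵥ x := Finset.single_le_sum (fun j _ => mul_self_nonneg (x j)) (Finset.mem_univ i)
    _ ≤ r := hx

end DotProduct

section BlockMatrix

variable {n : ℕ}

theorem blockMatrix_mulVec (A : Matrix (Fin n) (Fin n) ℝ) (x : Fin n ⊕ Fin n → ℝ) :
    blockMatrix A *ᵥ x =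
      Sum.elim (Aᵀ *ᵥ (x ∘ Sum.inr)) (-(A *ᵥ (x ∘ Sum.inl)) - x ∘ Sum.inr) := by
  rw [blockMatrix, Matrix.fromBlocks_mulVec, Matrix.zero_mulVec, zero_add, Matrix.neg_mulVec,
    Matrix.neg_mulVec, Matrix.one_mulVec, sub_eq_add_neg]

theorem continuous_blockMatrix : Continuous (blockMatrix (n := n)) :=
  Continuous.matrix_fromBlocks continuous_const continuous_id.matrix_transpose continuous_neg
    continuous_const

theorem dotProduct_blockMatrix_mulVec (A : Matrix (Fin n) (Fin n) ℝ) (x : Fin n ⊕ Fin n → ℝ) :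
    x ⬝ᵥ (blockMatrix A *ᵥ x) = -((x ∘ Sum.inr) ⬝ᵥ (x ∘ Sum.inr)) := by
  conv_lhs => rw [blockMatrix_mulVec, ← Sum.elim_comp_inl_inr x, sumElim_dotProduct_sumElim]
  rw [Sum.elim_comp_inl, Sum.elim_comp_inr, Matrix.mulVec_transpose, dotProduct_sub,
    dotProduct_neg, Matrix.dotProduct_mulVec, dotProduct_comm (x ∘ Sum.inl)]
  ring

theorem blockMatrix_mem_convexHull {𝒜 : Set (Matrix (Fin n) (Fin n) ℝ)}
    {M : Matrix (Fin n) (Fin n) ℝ} (hM : M ∈ convexHull ℝ 𝒜) :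
    blockMatrix M ∈ convexHull ℝ (blockMatrix '' 𝒜) := by
  have haffine : ∀ (A A' : Matrix (Fin n) (Fin n) ℝ) (a b : ℝ), a + b = 1 →
      blockMatrix (a • A + b • A') = a • blockMatrix A + b • blockMatrix A' := by
    intro A A' a b hab
    simp only [blockMatrix, Matrix.fromBlocks_smul, Matrix.fromBlocks_add, Matrix.transpose_add,
      Matrix.transpose_smul, smul_zero, add_zero, smul_neg, neg_add, ← add_smul, hab,
      ← neg_add (a • (1 : Matrix (Fin n) (Fin n) ℝ)), one_smul]
  have hconvex : Convex ℝ (blockMatrix ⁻¹' convexHull ℝ (blockMatrix '' 𝒜)) :=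
    fun A hA A' hA' a b ha hb hab => by
      rw [mem_preimage, haffine A A' a b hab]
      exact convex_convexHull ℝ _ hA hA' ha hb hab
  exact convexHull_min (image_subset_iff.1 (subset_convexHull ℝ _)) hconvex hM

theorem blockMatrix_mulVec_sumElim_zero (A : Matrix (Fin n) (Fin n) ℝ) (u : Fin n → ℝ) :
    blockMatrix A *ᵥ Sum.elim u (0 : Fin n → ℝ) = Sum.elim (0 : Fin n → ℝ) (-(A *ᵥ u)) := by
  rw [blockMatrix_mulVec, Sum.elim_comp_inl, Sum.elim_comp_inr, Matrix.mulVec_zero, sub_zero]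

theorem fderiv_dotProduct_self_blockMatrix_mulVec (A : Matrix (Fin n) (Fin n) ℝ)
    (x : Fin n ⊕ Fin n → ℝ) :
    fderiv ℝ (fun x : Fin n ⊕ Fin n → ℝ => x ⬝ᵥ x) x (blockMatrix A *ᵥ x) =
      -2 * ((x ∘ Sum.inr) ⬝ᵥ (x ∘ Sum.inr)) := by
  rw [(hasFDerivAt_dotProduct_self x).fderiv]
  change 2 * (x ⬝ᵥ (blockMatrix A *ᵥ x)) = _
  rw [dotProduct_blockMatrix_mulVec, mul_neg, neg_mul]

variable {g : (Fin n → ℝ) → StrongDual ℝ (Fin n → ℝ)}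

theorem contDiff_dual_inl_apply_inr {k : WithTop ℕ∞} (hg : ContDiff ℝ k g) :
    ContDiff ℝ k fun x : Fin n ⊕ Fin n → ℝ => g (x ∘ Sum.inl) (x ∘ Sum.inr) :=
  (hg.comp (contDiff_pi.2 fun i => contDiff_apply ℝ ℝ (Sum.inl i))).clm_apply
    (contDiff_pi.2 fun i => contDiff_apply ℝ ℝ (Sum.inr i))

theorem fderiv_dual_inl_apply_inr_blockMatrix_mulVec (hg : Differentiable ℝ g)
    (A : Matrix (Fin n) (Fin n) ℝ) {x : Fin n ⊕ Fin n → ℝ} (hx : x ∘ Sum.inr = 0) :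
    fderiv ℝ (fun x : Fin n ⊕ Fin n → ℝ => g (x ∘ Sum.inl) (x ∘ Sum.inr)) x
        (blockMatrix A *ᵥ x) =
      -g (x ∘ Sum.inl) (A *ᵥ (x ∘ Sum.inl)) := by
  let proj (i : Fin n → Fin n ⊕ Fin n) : (Fin n ⊕ Fin n → ℝ) →L[ℝ] (Fin n → ℝ) :=
    (LinearMap.funLeft ℝ ℝ i).toContinuousLinearMap
  have h : HasFDerivAt (fun x : Fin n ⊕ Fin n → ℝ => g (x ∘ Sum.inl) (x ∘ Sum.inr)) _ x :=
    ((hg _).hasFDerivAt.comp x (proj Sum.inl).hasFDerivAt).clm_apply (proj Sum.inr).hasFDerivAt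
  rw [h.fderiv]
  change g (x ∘ Sum.inl) ((blockMatrix A *ᵥ x) ∘ Sum.inr) +
    fderiv ℝ g (x ∘ Sum.inl) _ (x ∘ Sum.inr) = _
  rw [hx, map_zero, add_zero, blockMatrix_mulVec, Sum.elim_comp_inr, hx, sub_zero, map_neg]

end BlockMatrix

theorem exists_isNorm_contractsAtRate_blockMatrix {n : ℕ} {𝒜 : Set (Matrix (Fin n) (Fin n) ℝ)}
    (h𝒜 : IsCompact 𝒜) (hdet : ∀ M ∈ convexHull ℝ 𝒜, M.det ≠ 0) :
    ∃ (N : Seminorm ℝ (Fin n ⊕ Fin n → ℝ)) (a : ℝ), IsNorm N ∧ 0 < a ∧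
      ∀ B ∈ blockMatrix '' 𝒜, ContractsAtRate N a B := by
  have hne : ∀ p ∈ {p : Fin n → ℝ | 1 ≤ p ⬝ᵥ p}, ∀ M ∈ convexHull ℝ 𝒜, M *ᵥ p ≠ 0 := by
    intro p (hp : 1 ≤ p ⬝ᵥ p) M hM hMp
    have hp0 : p ≠ 0 := fun h0 => by norm_num [h0] at hp
    exact hdet M hM (Matrix.exists_mulVec_eq_zero_iff.1 ⟨p, hp0, hMp⟩)
  obtain ⟨g, hg, hgpos⟩ := exists_contDiff_dual_mulVec_pos h𝒜
    (isClosed_le continuous_const (contDiff_dotProduct_self (k := 0)).continuous) hne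
  refine exists_isNorm_contractsAtRate_of_weak_lyapunov (h𝒜.image continuous_blockMatrix)
    contDiff_dotProduct_self (contDiff_dual_inl_apply_inr (hg.of_le (by simp))) (by simp)
    (isBounded_dotProduct_self_le 3) ?_ ?_
  · rintro _ ⟨A, -, rfl⟩ x -
    rw [fderiv_dotProduct_self_blockMatrix_mulVec]
    exact mul_nonpos_of_nonpos_of_nonneg (by norm_num)
      (Finset.sum_nonneg fun i _ => mul_self_nonneg _)
  · rintro _ ⟨A, hA, rfl⟩ x hx hVx
    have hq : x ∘ Sum.inr = 0 := by
      rw [fderiv_dotProduct_self_blockMatrix_mulVec] at hVx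
      exact dotProduct_self_eq_zero.1 ((mul_eq_zero_iff_left (by norm_num)).1 hVx)
    have hp : 1 ≤ (x ∘ Sum.inl) ⬝ᵥ (x ∘ Sum.inl) := by
      rwa [← Sum.elim_comp_inl_inr x, sumElim_dotProduct_sumElim, hq, zero_dotProduct,
        add_zero] at hx
    rw [fderiv_dual_inl_apply_inr_blockMatrix_mulVec (hg.differentiable (by simp)) A hq]
    exact neg_neg_of_pos (hgpos _ hp A hA)

theorem det_ne_zero_of_contractsAtRate_blockMatrix {n : ℕ} {𝒜 : Set (Matrix (Fin n) (Fin n) ℝ)}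
    {N : Seminorm ℝ (Fin n ⊕ Fin n → ℝ)} (hN : IsNorm N) {a : ℝ} (ha : 0 < a)
    (h : ∀ B ∈ blockMatrix '' 𝒜, ContractsAtRate N a B) {M : Matrix (Fin n) (Fin n) ℝ}
    (hM : M ∈ convexHull ℝ 𝒜) : M.det ≠ 0 := by
  intro hdet
  obtain ⟨u, hu, hMu⟩ := Matrix.exists_mulVec_eq_zero_iff.2 hdet
  have hx : Sum.elim u (0 : Fin n → ℝ) ≠ 0 := fun h0 =>
    hu (by simpa using congrArg (· ∘ Sum.inl) h0)
  refine mulVec_ne_zero_of_mem_convexHull_of_contractsAtRate hN ha h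
    (blockMatrix_mem_convexHull hM) hx ?_
  rw [blockMatrix_mulVec_sumElim_zero, hMu, neg_zero, Sum.elim_zero_zero]

theorem lemma4_general {n : ℕ} {𝒜 : Set (Matrix (Fin n) (Fin n) ℝ)} (h𝒜 : IsCompact 𝒜) :
    (∃ (N : Seminorm ℝ (Fin n ⊕ Fin n → ℝ)) (a : ℝ), IsNorm N ∧ 0 < a ∧
      ∀ t : ℝ, 0 ≤ t → ∀ A ∈ 𝒜,
        inducedNorm N (NormedSpace.exp (t • blockMatrix A)) ≤ Real.exp (-a * t)) ↔
    ∀ M ∈ convexHull ℝ 𝒜, M.det ≠ 0 := by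
  constructor
  · rintro ⟨N, a, hN, ha, h⟩ M hM
    refine det_ne_zero_of_contractsAtRate_blockMatrix hN ha (forall_mem_image.2 fun A hA => ?_) hM
    exact hN.contractsAtRate_iff.2 fun t ht => h t ht A hA
  · intro hdet
    obtain ⟨N, a, hN, ha, h⟩ := exists_isNorm_contractsAtRate_blockMatrix h𝒜 hdet
    exact ⟨N, a, hN, ha, fun t ht A hA =>
      hN.contractsAtRate_iff.1 (h _ (mem_image_of_mem _ hA)) t ht⟩

theorem lemma4 (k n : ℕ) (A : Fin k → Matrix (Fin n) (Fin n) ℝ) :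
    (∃ (N : Seminorm ℝ (Fin n ⊕ Fin n → ℝ)) (a : ℝ), IsNorm N ∧ 0 < a ∧
      ∀ t : ℝ, 0 ≤ t → ∀ i : Fin k,
        inducedNorm N (NormedSpace.exp (t • blockMatrix (A i))) ≤ Real.exp (-a * t)) ↔
    ∀ M ∈ convexHull ℝ (Set.range A), M.det ≠ 0 := by
  simpa only [forall_mem_range] using lemma4_general (finite_range A).isCompact
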